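/- **Setting.** For every dimension $d\ge 2$ let $P_d$ be a continuous (i.e. $P_d(\{x\})=0$ for every $x$), spherically symmetric probability distribution on $\mathbb R^d$: if $X\sim P_d$, then $HX\sim P_d$ for every orthogonal $d\times d$ matrix $H$. For every sample size $n$ and every $d\ge 2$ let $X_1,\dots,X_n\sim P_d$ and $U_1,\dots,U_n\sim\mathrm{Unif}(S^{d-1})$ be mutually independent random vectors, and put $X_i'=\|X_i\|U_i$. For $s\in\{0,1\}^n$ let $Y_{s_i,i}=X_i$ if $s_i=1$ and $Y_{s_i,i}=X_i'$ if $s_i=0$. Let $\theta(x,y)=\exp\{-(\tfrac1d x^\top y)^2\}$ and let $$(S,\Pi)\in\operatorname*{arg\,min}_{s\in\{0,1\}^n,\ \pi\in\mathcal S_n}\ \sum_{i=1}^{n-1}\theta\big(Y_{s_{\pi_i},\pi_i},\,Y_{s_{\pi_{i+1}},\pi_{i+1}}\big)$$ almost surely, where $\mathcal S_n$ is the set of permutations $\pi = (\pi_1,\dots,\pi_n)$ of $\{1,\dots,n\}$ and the minimizer may be selected in any way (a path and its reversal have the same cost). With $\Pi=(\pi_1,\dots,\pi_n)$, the runs statistic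 is $$T_R=1+\sum_{i=1}^{n-1}\mathbf 1\{S_{\pi_i}\ne S_{\pi_{i+1}}\}.$$ **Theorem 3.5.** As $n\to\infty$ and $d\to\infty$ (jointly, at arbitrary rates), $$\frac{T_R-(n+1)/2}{\sqrt n}\ \xrightarrow{\ D\ }\ \mathcal N\!\left(0,\tfrac14\right).$$ The limit does not depend on the dimension: for every fixed $d\ge 2$ the same convergence holds as $n\to\infty$. -/

import Mathlib

open MeasureTheory ProbabilityTheory Filter

noncomputable section

namespace SphericalRuns

/-- The dimensions under consideration: integers `d > 1`. -/
abbrev Dim : Type := {d : ℕ // 2 ≤ d}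

/-- `d`-dimensional Euclidean space. -/
abbrev E (d : ℕ) : Type := EuclideanSpace ℝ (Fin d)

/-- `P` is spherically symmetric about the origin: `X` and `H X` have the same law for every
orthogonal transformation `H` (the linear isometries of Euclidean space onto itself are exactly the
maps given by orthogonal matrices). -/
def IsSphericallySymmetric {d : ℕ} (P : Measure (E d)) : Prop :=
  ∀ H : E d ≃ₗᵢ[ℝ] E d, P.map H = P

/-- The uniform distribution on the unit sphere: the normalized surface measure, regarded as a
measure on the ambient space. -/
def uniformSphere (d : ℕ) : Measure (E d) :=
  (((volume : Measure (E d)).toSphere Set.univ)⁻¹ • (volume : Measure (E d)).toSphere).map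
    (fun u : Metric.sphere (0 : E d) 1 => (u : E d))

/-- `X₁, …, Xₙ` are i.i.d. with law `P`, `U₁, …, Uₙ` are i.i.d. uniform on the unit sphere, and the
two samples are independent of one another. -/
structure IsAugmentedSample {Ω : Type*} [MeasurableSpace Ω] (μ : Measure Ω) {n d : ℕ}
    (P : Measure (E d)) (X U : Fin n → Ω → E d) : Prop where
  law_X : ∀ i, HasLaw (X i) P μ
  law_U : ∀ i, HasLaw (U i) (uniformSphere d) μ
  indep : iIndepFun (Sum.elim X U) μ

/-- The spherically symmetric variants `Xᵢ' = ‖Xᵢ‖ Uᵢ`. -/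
def variant {n d : ℕ} (x u : Fin n → E d) : Fin n → E d :=
  fun i => ‖x i‖ • u i

/-- The cost `θ(x, y) = exp (-(xᵀy / d)²)` of the edge joining `x` and `y`. -/
def edgeCost {d : ℕ} (x y : E d) : ℝ :=
  Real.exp (-(((1 / (d : ℝ)) * inner ℝ x y) ^ 2))

/-- The vertex `Yᵢ` visited by a path with signs `s`: it is `Xᵢ` if `sᵢ = 1` (`true`) and `Xᵢ'` if
`sᵢ = 0` (`false`). -/
def vertex {n d : ℕ} (x x' : Fin n → E d) (s : Fin n → Bool) (i : Fin n) : E d :=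
  if s i then x i else x' i

/-- The position `i` (among `1, …, n - 1`) of a path with `n` vertices. -/
def pos {n : ℕ} (i : Fin (n - 1)) : Fin n := ⟨i, by omega⟩

/-- The position following `i` on a path with `n` vertices. -/
def nextPos {n : ℕ} (i : Fin (n - 1)) : Fin n := ⟨i + 1, by omega⟩

/-- The total cost of the covering path that visits, in this order, the vertices
`Y_{π₁}, …, Y_{πₙ}`. -/
def pathCost {n d : ℕ} (x x' : Fin n → E d) (s : Fin n → Bool) (π : Equiv.Perm (Fin n)) : ℝ :=
  ∑ i : Fin (n - 1),
    edgeCost (vertex x x' s (π (pos i))) (vertex x x' s (π (nextPos i)))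

/-- `(s, π)` describes a shortest covering path: it minimizes the cost over all sign vectors and all
permutations. -/
def IsShortestCoveringPath {n d : ℕ} (x x' : Fin n → E d) (s : Fin n → Bool)
    (π : Equiv.Perm (Fin n)) : Prop :=
  ∀ (t : Fin n → Bool) (σ : Equiv.Perm (Fin n)), pathCost x x' s π ≤ pathCost x x' t σ

/-- The runs statistic `T_R = 1 + ∑ᵢ 1{s_{πᵢ} ≠ s_{πᵢ₊₁}}`, the sum running over
`1 ≤ i ≤ n - 1`. -/
def runsStatistic {n : ℕ} (s : Fin n → Bool) (π : Equiv.Perm (Fin n)) : ℕ :=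
  1 + ∑ i : Fin (n - 1), if s (π (pos i)) ≠ s (π (nextPos i)) then 1 else 0

/-- The normalized runs statistic `(T_R - (n + 1) / 2) / √n`. -/
def normalizedRuns {n : ℕ} (s : Fin n → Bool) (π : Equiv.Perm (Fin n)) : ℝ :=
  ((runsStatistic s π : ℝ) - ((n : ℝ) + 1) / 2) / Real.sqrt n

end SphericalRuns

end

/-! Given its norm, a spherically symmetric X has uniform direction, so X and X' = ‖X‖U are
exchangeable (`pairLaw_map_flip`). Exchanging the members of the pairs selected by τ therefore
preserves the law of the configuration. It turns an optimal path (s, π) into (τ xor s, π), and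
averaging over all τ replaces the signs along the path by independent fair bits
(`integral_minimalRuns`). Thus for n ≥ 1, T_R - 1 is exactly Binomial(n - 1, 1/2) in every
dimension, with normalized characteristic function cos(u / (2√n))^(n - 1) → exp(-u²/8). As the law
is free of d, joint and fixed-dimension limits coincide.

The delicate point is the arbitrary choice of minimizer. T_R depends only on the edge set of the
path, so it suffices that distinct edge sets almost surely have distinct weights
(`ae_totalWeight_ne`). Take an edge uv in A but not in B and rotate u and v by independent angles φ,
ψ in a coordinate plane, which preserves the law. The weight difference is analytic in φ, and its
mixed second differences are those of k(φ - ψ), the cost of uv alone. A bounded nonconstant analytic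
k prevents it from vanishing on a set of positive measure, and Fubini concludes. Continuity of P
enters only through P({0}) = 0. -/

namespace SphericalRuns

open scoped ContDiff Topology RealInnerProductSpace

/-! ### Analytic functions of angles and plane rotations -/

/-- The zero set of a real-analytic function on the line that is not identically zero is null. -/
lemma ae_ne_zero_of_contDiff_omega {f : ℝ → ℝ} (hf : ContDiff ℝ ω f) {x₀ : ℝ} (h : f x₀ ≠ 0) :
    ∀ᵐ x, f x ≠ 0 := by
  have hA : AnalyticOnNhd ℝ f Set.univ := contDiff_omega_iff_analyticOnNhd.1 hf
  have hfreq : ∀ x, ∀ᶠ z in 𝓝[≠] x, f z ≠ 0 := by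
    intro x
    rcases (hA x trivial).eventually_eq_zero_or_eventually_ne_zero with h0 | h0
    · exact absurd (hA.eqOn_zero_of_preconnected_of_eventuallyEq_zero isPreconnected_univ
        (Set.mem_univ x) h0 (Set.mem_univ x₀)) h
    · exact h0
  have hcod : {x | f x ≠ 0} ∈ codiscreteWithin (Set.univ : Set ℝ) := by
    rw [mem_codiscreteWithin_iff_forall_mem_nhdsNE]
    intro x _
    simpa only [Set.compl_univ, Set.union_empty] using! hfreq x
  have := ae_restrict_le_codiscreteWithin (μ := (volume : Measure ℝ)) MeasurableSet.univ hcod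
  rw [Measure.restrict_univ] at this
  exact this

/-- If the mixed second differences of `F` are those of `k (φ - ψ)` for a bounded nonconstant
analytic function `k`, then `F` is almost everywhere nonzero. -/
lemma ae_ae_ne_zero_of_mixed_difference {F : ℝ → ℝ → ℝ} {k : ℝ → ℝ}
    (hF : ∀ ψ, ContDiff ℝ ω fun φ => F φ ψ) (hk : ContDiff ℝ ω k) {C : ℝ} (hC : ∀ t, |k t| ≤ C)
    {t₀ : ℝ} (ht₀ : k t₀ ≠ k 0)
    (hmix : ∀ φ φ' ψ ψ', F φ ψ - F φ ψ' - F φ' ψ + F φ' ψ' =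
      k (φ - ψ) - k (φ - ψ') - k (φ' - ψ) + k (φ' - ψ')) :
    ∀ᵐ ψ, ∀ᵐ φ, F φ ψ ≠ 0 := by
  by_cases hex : ∃ ψ₀, ∀ φ, F φ ψ₀ = 0
  · obtain ⟨ψ₀, hψ₀⟩ := hex
    -- Two vanishing sections, at ψ and ψ₀, make k(x + δ) - k(x) a constant c. Then k grows linearly
    -- along multiples of δ, so boundedness forces c = 0.
    have key : ∀ ψ, (∀ φ, F φ ψ = 0) → k (ψ₀ - ψ) - k 0 = 0 := by
      intro ψ hψ
      have hconst : ∀ x y, k (x + (ψ₀ - ψ)) - k x = k (y + (ψ₀ - ψ)) - k y := by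
        intro x y
        have := hmix (x + ψ₀) (y + ψ₀) ψ ψ₀
        simp only [hψ, hψ₀] at this
        have e1 : ∀ z, z + ψ₀ - ψ = z + (ψ₀ - ψ) := fun z => by ring
        simp only [e1, add_sub_cancel_right] at this
        linarith
      set δ := ψ₀ - ψ
      set c := k δ - k 0 with hc
      have hstep : ∀ x, k (x + δ) = k x + c := fun x => by
        have := hconst x 0
        simp only [zero_add] at this
        linarith
      have hit : ∀ n : ℕ, k (n * δ) = k 0 + n * c := by
        intro n
        induction n with
        | zero => simp
        | succ m ih =>
          have : ((m + 1 : ℕ) : ℝ) * δ = m * δ + δ := by push_cast; ring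
          rw [this, hstep, ih]; push_cast; ring
      by_contra hne
      obtain ⟨n, hn⟩ := exists_nat_gt (2 * C / |c|)
      have hcpos : 0 < |c| := abs_pos.2 hne
      rw [div_lt_iff₀ hcpos] at hn
      have h1 : (n : ℝ) * |c| = |k (n * δ) - k 0| := by
        rw [hit]; simp [abs_mul]
      have h2 : |k (n * δ) - k 0| ≤ |k (n * δ)| + |k 0| := abs_sub _ _
      linarith [hC (n * δ), hC 0]
    have hnull : ∀ᵐ ψ, k (ψ₀ - ψ) - k 0 ≠ 0 :=
      ae_ne_zero_of_contDiff_omega (f := fun ψ => k (ψ₀ - ψ) - k 0) (x₀ := ψ₀ - t₀)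
        ((hk.comp (contDiff_const.sub contDiff_id)).sub contDiff_const)
        (by simpa [sub_eq_zero] using ht₀)
    filter_upwards [hnull] with ψ hψ
    have : ∃ φ, F φ ψ ≠ 0 := by
      by_contra! hcon
      exact hψ (key ψ hcon)
    obtain ⟨φ, hφ⟩ := this
    exact ae_ne_zero_of_contDiff_omega (hF ψ) hφ
  · push Not at hex
    refine Eventually.of_forall fun ψ => ?_
    obtain ⟨φ, hφ⟩ := hex ψ
    exact ae_ne_zero_of_contDiff_omega (hF ψ) hφ

/-- The edge cost along two rotating vertices is a nonconstant function of the angle. -/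
lemma exists_ne_of_trig_amplitude_ne_zero {a b c m : ℝ} (hm : m ≠ 0) (hab : a ^ 2 + b ^ 2 ≠ 0) :
    ∃ t, Real.exp (-((m * (c + a * (Real.cos t - 1) + b * Real.sin t)) ^ 2)) ≠
      Real.exp (-((m * (c + a * (Real.cos 0 - 1) + b * Real.sin 0)) ^ 2)) := by
  by_contra! h
  have h' : ∀ t, (c - a + (a * Real.cos t + b * Real.sin t)) ^ 2 = c ^ 2 := by
    intro t
    have := Real.exp_injective (h t)
    simp only [Real.cos_zero, Real.sin_zero, neg_inj, mul_pow, sub_self, mul_zero, add_zero] at this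
    have := mul_left_cancel₀ (pow_ne_zero 2 hm) this
    rw [← this]; ring
  -- The half and quarter turns give a² = b² and (c - a)b = 0; the eighth turns then give ab = 0,
  -- hence a = b = 0.
  have h0 := h' 0
  have hp := h' Real.pi
  have h2 := h' (Real.pi / 2)
  have h3 := h' (-(Real.pi / 2))
  have h4 := h' (Real.pi / 4)
  have h5 := h' (-(Real.pi / 4))
  simp only [Real.cos_zero, Real.sin_zero, Real.cos_pi, Real.sin_pi, Real.cos_pi_div_two,
    Real.sin_pi_div_two, Real.cos_neg, Real.sin_neg, Real.cos_pi_div_four,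
    Real.sin_pi_div_four] at h0 hp h2 h3 h4 h5
  set s := √2 / 2 with hs
  have hss : s ^ 2 = 1 / 2 := by rw [hs, div_pow, Real.sq_sqrt (by norm_num)]; norm_num
  have e1 : a ^ 2 = b ^ 2 := by linarith
  have e2 : (c - a) * a = 0 := by linarith
  have e3 : (c - a) * b = 0 := by linarith
  have e4 : a * b * s ^ 2 = 0 := by
    linear_combination (h4 - h5) / 4 - s * e3
  rw [hss] at e4
  have e5 : a * b = 0 := by linarith
  rcases mul_eq_zero.1 e5 with h | h <;> rw [h] at e1 <;> apply hab <;> rw [h] <;> nlinarith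

/-- A one-parameter family of rotations in the plane of an orthonormal pair. -/
lemma exists_plane_rotation {d : ℕ} {e f : E d} (he : ⟪e, e⟫ = 1) (hf : ⟪f, f⟫ = 1)
    (hef : ⟪e, f⟫ = 0) :
    ∃ R : ℝ → E d ≃ₗᵢ[ℝ] E d, (∀ x, ContDiff ℝ ω fun φ => R φ x) ∧
      (Continuous fun p : ℝ × E d => R p.1 p.2) ∧
      (∀ φ x, ⟪e, R φ x⟫ ^ 2 + ⟪f, R φ x⟫ ^ 2 = ⟪e, x⟫ ^ 2 + ⟪f, x⟫ ^ 2) ∧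
      ∀ φ ψ x y, ⟪R φ x, R ψ y⟫ = ⟪x, y⟫ +
        (⟪e, x⟫ * ⟪e, y⟫ + ⟪f, x⟫ * ⟪f, y⟫) * (Real.cos (φ - ψ) - 1) +
        (⟪e, x⟫ * ⟪f, y⟫ - ⟪f, x⟫ * ⟪e, y⟫) * Real.sin (φ - ψ) := by
  have hfe : ⟪f, e⟫ = 0 := by rw [real_inner_comm, hef]
  -- The identity plus (rotation - 1) applied to the projection onto span(e, f).
  let r : ℝ → E d → E d := fun φ x =>
    x + ((Real.cos φ - 1) * ⟪e, x⟫ - Real.sin φ * ⟪f, x⟫) • e +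
      (Real.sin φ * ⟪e, x⟫ + (Real.cos φ - 1) * ⟪f, x⟫) • f
  have hr : ∀ φ ψ x y, ⟪r φ x, r ψ y⟫ = ⟪x, y⟫ +
        (⟪e, x⟫ * ⟪e, y⟫ + ⟪f, x⟫ * ⟪f, y⟫) * (Real.cos (φ - ψ) - 1) +
        (⟪e, x⟫ * ⟪f, y⟫ - ⟪f, x⟫ * ⟪e, y⟫) * Real.sin (φ - ψ) := by
    intro φ ψ x y
    simp only [r, inner_add_left, inner_add_right, real_inner_smul_left, real_inner_smul_right,
      he, hf, hef, hfe, real_inner_comm e x, real_inner_comm f x, Real.cos_sub, Real.sin_sub]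
    ring
  let L : ℝ → E d →ₗᵢ[ℝ] E d := fun φ =>
    { toFun := r φ
      map_add' := fun x y => by
        simp only [r, inner_add_right]
        module
      map_smul' := fun c x => by
        simp only [r, real_inner_smul_right, RingHom.id_apply]
        module
      norm_map' := fun x => by
        have := hr φ φ x x
        simp only [sub_self, Real.cos_zero, Real.sin_zero, mul_zero, add_zero] at this
        change ‖r φ x‖ = ‖x‖
        rw [@norm_eq_sqrt_real_inner _ _ _ (r φ x), this, ← norm_eq_sqrt_real_inner] }
  refine ⟨fun φ => (L φ).toLinearIsometryEquiv rfl, ?_, ?_, ?_, ?_⟩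
  · intro x
    change ContDiff ℝ ω fun φ => r φ x
    have h1 := Real.contDiff_cos (n := ω)
    have h2 := Real.contDiff_sin (n := ω)
    simp only [r]
    fun_prop
  · change Continuous fun p : ℝ × E d => r p.1 p.2
    simp only [r]
    fun_prop
  · intro φ x
    change ⟪e, r φ x⟫ ^ 2 + ⟪f, r φ x⟫ ^ 2 = _
    simp only [r, inner_add_right, real_inner_smul_right, he, hf, hef, hfe]
    linear_combination (⟪e, x⟫ ^ 2 + ⟪f, x⟫ ^ 2) * Real.sin_sq_add_cos_sq φ
  · exact hr

end SphericalRuns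

noncomputable section

namespace SphericalRuns

open scoped ContDiff Topology RealInnerProductSpace

/-! ### Almost sure distinctness of edge-set weights -/

/-- The weight of an edge of the complete graph on the vertices `y i b`. -/
def edgeWeight {n d : ℕ} (y : Fin n → Bool → E d) : Sym2 (Fin n × Bool) → ℝ :=
  Sym2.lift ⟨fun u v => edgeCost (y u.1 u.2) (y v.1 v.2), fun u v => by
    simp only [edgeCost, real_inner_comm]⟩

/-- The total weight of a set of edges. -/
def totalWeight {n d : ℕ} (y : Fin n → Bool → E d)
    (A : Finset (Sym2 (Fin n × Bool))) : ℝ :=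
  ∑ e ∈ A, edgeWeight y e

@[simp]
lemma edgeWeight_mk {n d : ℕ} (y : Fin n → Bool → E d) (u v : Fin n × Bool) :
    edgeWeight y s(u, v) = edgeCost (y u.1 u.2) (y v.1 v.2) := rfl

lemma measurable_edgeWeight {n d : ℕ} (e : Sym2 (Fin n × Bool)) :
    Measurable fun y : Fin n → Bool → E d => edgeWeight y e := by
  induction e using Sym2.ind with
  | _ u v =>
    simp only [edgeWeight_mk, edgeCost]
    fun_prop

lemma measurable_totalWeight {n d : ℕ} (A : Finset (Sym2 (Fin n × Bool))) :
    Measurable fun y : Fin n → Bool → E d => totalWeight y A := by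
  unfold totalWeight
  exact Finset.measurable_fun_sum _ fun e _ => measurable_edgeWeight e

lemma edgeWeight_congr {n d : ℕ} {y z : Fin n → Bool → E d} {e : Sym2 (Fin n × Bool)}
    (h : ∀ u ∈ e, y u.1 u.2 = z u.1 u.2) : edgeWeight y e = edgeWeight z e := by
  induction e using Sym2.ind with
  | _ u v => simp [h u (by simp), h v (by simp)]

/-- Rotating the vertex `u` by `g` and the vertex `v` by `h`. -/
def moveVertices {n d : ℕ} (u v : Fin n × Bool) (g h : E d ≃ₗᵢ[ℝ] E d) (y : Fin n → Bool → E d) :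
    Fin n → Bool → E d :=
  fun i b => (if (i, b) = u then g else if (i, b) = v then h else .refl ℝ (E d)) (y i b)

/-- The law of a pair of vertices is invariant under separate isometries. -/
def IsBiinvariant {d : ℕ} (Q : Measure (Bool → E d)) : Prop :=
  ∀ H : Bool → (E d ≃ₗᵢ[ℝ] E d), Q.map (fun q b => H b (q b)) = Q

/-- u and v may belong to the same pair, whose entries are dependent; hence the need for invariance
under separate isometries. -/
lemma measurePreserving_moveVertices {n d : ℕ} {Q : Measure (Bool → E d)} [IsProbabilityMeasure Q]
    (hQ : IsBiinvariant Q) (u v : Fin n × Bool) (g h : E d ≃ₗᵢ[ℝ] E d) :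
    MeasurePreserving (moveVertices u v g h) (Measure.pi fun _ : Fin n => Q)
      (Measure.pi fun _ : Fin n => Q) :=
  measurePreserving_pi (f := fun (i : Fin n) (q : Bool → E d) (b : Bool) =>
      (if (i, b) = u then g else if (i, b) = v then h else .refl ℝ (E d)) (q b)) _ _ fun i =>
    ⟨by
      refine measurable_pi_lambda _ fun b => ?_
      exact (LinearIsometryEquiv.continuous _).measurable.comp (measurable_pi_apply b), hQ _⟩

/-- Any edge other than uv contains at most one moved vertex, so its weight depends on at most one
angle and cancels. -/
lemma mixed_difference_totalWeight {n d : ℕ} {u v : Fin n × Bool} (huv : u ≠ v)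
    (R : ℝ → E d ≃ₗᵢ[ℝ] E d) (y : Fin n → Bool → E d) {A B : Finset (Sym2 (Fin n × Bool))}
    (hA : s(u, v) ∈ A) (hB : s(u, v) ∉ B) (φ φ' ψ ψ' : ℝ) :
    let F := fun φ ψ => totalWeight (moveVertices u v (R φ) (R ψ) y) A -
      totalWeight (moveVertices u v (R φ) (R ψ) y) B
    let G := fun φ ψ => edgeCost (R φ (y u.1 u.2)) (R ψ (y v.1 v.2))
    F φ ψ - F φ ψ' - F φ' ψ + F φ' ψ' = G φ ψ - G φ ψ' - G φ' ψ + G φ' ψ' := by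
  intro F G
  let w : ℝ → ℝ → Sym2 (Fin n × Bool) → ℝ := fun φ ψ e =>
    edgeWeight (moveVertices u v (R φ) (R ψ) y) e
  have hzero : ∀ e, e ≠ s(u, v) → w φ ψ e - w φ ψ' e - w φ' ψ e + w φ' ψ' e = 0 := by
    intro e he
    by_cases hu : u ∈ e
    · have hv : v ∉ e := fun hv => he ((Sym2.mem_and_mem_iff huv).1 ⟨hu, hv⟩)
      have : ∀ φ, w φ ψ e = w φ ψ' e := fun φ => edgeWeight_congr fun p hp => by
        have : p ≠ v := fun h => hv (h ▸ hp)
        simp [moveVertices, this]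
      rw [this, this]; ring
    · have : ∀ ψ, w φ ψ e = w φ' ψ e := fun ψ => edgeWeight_congr fun p hp => by
        have : p ≠ u := fun h => hu (h ▸ hp)
        simp [moveVertices, this]
      rw [this, this]; ring
  have hmain : ∀ φ ψ, w φ ψ s(u, v) = G φ ψ := by
    intro φ ψ
    simp [w, G, moveVertices, huv.symm]
  have hsum : ∀ D : Finset (Sym2 (Fin n × Bool)),
      ∑ e ∈ D, w φ ψ e - ∑ e ∈ D, w φ ψ' e - ∑ e ∈ D, w φ' ψ e + ∑ e ∈ D, w φ' ψ' e =
        ∑ e ∈ D, (w φ ψ e - w φ ψ' e - w φ' ψ e + w φ' ψ' e) := fun D => by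
    simp only [Finset.sum_add_distrib, Finset.sum_sub_distrib]
  have h1 := hsum A
  have h2 := hsum B
  rw [Finset.sum_eq_single_of_mem _ hA fun e _ he => hzero e he, hmain, hmain, hmain, hmain] at h1
  rw [Finset.sum_eq_zero fun e he => hzero e fun h => hB (h ▸ he)] at h2
  change (∑ e ∈ A, w φ ψ e - ∑ e ∈ B, w φ ψ e) - (∑ e ∈ A, w φ ψ' e - ∑ e ∈ B, w φ ψ' e) -
    (∑ e ∈ A, w φ' ψ e - ∑ e ∈ B, w φ' ψ e) + (∑ e ∈ A, w φ' ψ' e - ∑ e ∈ B, w φ' ψ' e) = _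
  linarith

lemma contDiff_totalWeight_moveVertices {n d : ℕ} (u v : Fin n × Bool)
    {R : ℝ → E d ≃ₗᵢ[ℝ] E d} (hR : ∀ x, ContDiff ℝ ω fun φ => R φ x) (h : E d ≃ₗᵢ[ℝ] E d)
    (y : Fin n → Bool → E d) (A : Finset (Sym2 (Fin n × Bool))) :
    ContDiff ℝ ω fun φ => totalWeight (moveVertices u v (R φ) h y) A := by
  have hv : ∀ p : Fin n × Bool, ContDiff ℝ ω fun φ => moveVertices u v (R φ) h y p.1 p.2 := by
    intro p
    simp only [moveVertices]
    split_ifs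
    · exact hR _
    · exact contDiff_const
    · exact contDiff_const
  refine ContDiff.sum fun e _ => ?_
  induction e using Sym2.ind with
  | _ p q =>
    simp only [edgeWeight_mk, edgeCost]
    exact (((contDiff_const.mul ((hv p).inner ℝ (hv q))).pow 2).neg).exp

/-- The plane may depend on the vectors because there are only finitely many coordinate planes to
discard null sets for. -/
lemma exists_coordinates_ne_zero {d : ℕ} (hd : 2 ≤ d) {x y : E d} (hx : x ≠ 0) (hy : y ≠ 0) :
    ∃ j k : Fin d, j ≠ k ∧ x j ^ 2 + x k ^ 2 ≠ 0 ∧ y j ^ 2 + y k ^ 2 ≠ 0 := by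
  have : Nontrivial (Fin d) := Fin.nontrivial_iff_two_le.2 hd
  have key : ∀ z : E d, z ≠ 0 → ∃ j, z j ≠ 0 := by
    intro z hz
    by_contra! h
    exact hz (by ext i; simpa using h i)
  obtain ⟨j, hj⟩ := key x hx
  obtain ⟨k, hk⟩ := key y hy
  by_cases hjk : j = k
  · subst hjk
    obtain ⟨l, hl⟩ := exists_ne j
    exact ⟨j, l, hl.symm, by positivity, by positivity⟩
  · exact ⟨j, k, hjk, by positivity, by positivity⟩

lemma ae_totalWeight_ne_of_coordinates {n d : ℕ} (hd : 2 ≤ d) {Q : Measure (Bool → E d)}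
    [IsProbabilityMeasure Q] (hQ : IsBiinvariant Q) {u v : Fin n × Bool} (huv : u ≠ v)
    {A B : Finset (Sym2 (Fin n × Bool))} (hA : s(u, v) ∈ A) (hB : s(u, v) ∉ B) {j k : Fin d}
    (hjk : j ≠ k) :
    ∀ᵐ y ∂Measure.pi fun _ : Fin n => Q,
      (y u.1 u.2 j ^ 2 + y u.1 u.2 k ^ 2 ≠ 0 ∧ y v.1 v.2 j ^ 2 + y v.1 v.2 k ^ 2 ≠ 0) →
        totalWeight y A ≠ totalWeight y B := by
  set M := Measure.pi fun _ : Fin n => Q with hM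
  obtain ⟨R, hR, hRc, hRn, hRi⟩ := exists_plane_rotation (d := d)
    (e := EuclideanSpace.single j 1) (f := EuclideanSpace.single k 1)
    (by rw [EuclideanSpace.inner_single_left]; simp)
    (by rw [EuclideanSpace.inner_single_left]; simp)
    (by rw [EuclideanSpace.inner_single_left]; simp [hjk])
  have hin : ∀ (l : Fin d) (x : E d), ⟪EuclideanSpace.single l (1 : ℝ), x⟫ = x l := fun l x => by
    rw [EuclideanSpace.inner_single_left]
    simp
  simp only [hin] at hRn hRi
  set N : (Fin n → Bool → E d) → Prop := fun y =>
    y u.1 u.2 j ^ 2 + y u.1 u.2 k ^ 2 ≠ 0 ∧ y v.1 v.2 j ^ 2 + y v.1 v.2 k ^ 2 ≠ 0 with hN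
  let good : (Fin n → Bool → E d) → Prop := fun y => N y → totalWeight y A ≠ totalWeight y B
  have hgood : MeasurableSet {y | good y} := by
    have hNm : MeasurableSet {y | N y} := by
      have h0 : MeasurableSet ({0}ᶜ : Set ℝ) := (measurableSet_singleton _).compl
      have hm : ∀ p : Fin n × Bool, Measurable fun y : Fin n → Bool → E d =>
          y p.1 p.2 j ^ 2 + y p.1 p.2 k ^ 2 := fun p => by fun_prop
      exact (hm u h0).inter (hm v h0)
    have hEm : MeasurableSet {y : Fin n → Bool → E d | totalWeight y A = totalWeight y B} :=
      measurableSet_eq_fun (measurable_totalWeight A) (measurable_totalWeight B)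
    have : {y | good y} = {y | N y}ᶜ ∪ {y | totalWeight y A = totalWeight y B}ᶜ := by
      ext y
      simp only [good, Set.mem_ofPred_eq, Set.mem_union, Set.mem_compl_iff]
      tauto
    rw [this]
    exact hNm.compl.union hEm.compl
  -- The angle of v comes first: Fubini fixes ψ outside and varies φ inside.
  let T : ℝ × ℝ → (Fin n → Bool → E d) → (Fin n → Bool → E d) := fun p y =>
    moveVertices u v (R p.2) (R p.1) y
  have hTm : Measurable fun p : (ℝ × ℝ) × (Fin n → Bool → E d) => T p.1 p.2 := by
    refine measurable_pi_lambda _ fun i => measurable_pi_lambda _ fun b => ?_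
    simp only [T, moveVertices]
    have hy : Measurable fun p : (ℝ × ℝ) × (Fin n → Bool → E d) => p.2 i b := by fun_prop
    split_ifs
    · exact hRc.measurable.comp ((measurable_fst.snd).prodMk hy)
    · exact hRc.measurable.comp ((measurable_fst.fst).prodMk hy)
    · exact hy
  have hfib : ∀ y, ∀ᵐ p : ℝ × ℝ, good (T p y) := by
    intro y
    by_cases hNy : N y
    · have hms : MeasurableSet {p : ℝ × ℝ | good (T p y)} :=
        (hTm.comp (measurable_id.prodMk measurable_const)) hgood
      rw [Measure.volume_eq_prod, Measure.ae_prod_iff_ae_ae hms]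
      let K : ℝ → ℝ := fun t => Real.exp (-(((1 / (d : ℝ)) * (⟪y u.1 u.2, y v.1 v.2⟫ +
        (y u.1 u.2 j * y v.1 v.2 j + y u.1 u.2 k * y v.1 v.2 k) * (Real.cos t - 1) +
        (y u.1 u.2 j * y v.1 v.2 k - y u.1 u.2 k * y v.1 v.2 j) * Real.sin t)) ^ 2))
      have hKd : ContDiff ℝ ω K := by
        have h1 := Real.contDiff_cos (n := ω)
        have h2 := Real.contDiff_sin (n := ω)
        simp only [K]
        fun_prop
      obtain ⟨t₀, ht₀⟩ : ∃ t, K t ≠ K 0 := by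
        -- The squared amplitude factors into the squared lengths of the two plane projections.
        refine exists_ne_of_trig_amplitude_ne_zero (by positivity) ?_
        have : (y u.1 u.2 j * y v.1 v.2 j + y u.1 u.2 k * y v.1 v.2 k) ^ 2 +
            (y u.1 u.2 j * y v.1 v.2 k - y u.1 u.2 k * y v.1 v.2 j) ^ 2 =
            (y u.1 u.2 j ^ 2 + y u.1 u.2 k ^ 2) * (y v.1 v.2 j ^ 2 + y v.1 v.2 k ^ 2) := by ring
        rw [this]
        exact mul_ne_zero hNy.1 hNy.2
      have hKb : ∀ t, |K t| ≤ 1 := fun t => by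
        rw [abs_of_pos (Real.exp_pos _)]
        exact Real.exp_le_one_iff.2 (neg_nonpos.2 (sq_nonneg _))
      have hG : ∀ φ ψ, edgeCost (R φ (y u.1 u.2)) (R ψ (y v.1 v.2)) = K (φ - ψ) := fun φ ψ => by
        simp only [edgeCost, hRi, K]
      have hmain := ae_ae_ne_zero_of_mixed_difference
        (F := fun φ ψ => totalWeight (moveVertices u v (R φ) (R ψ) y) A -
          totalWeight (moveVertices u v (R φ) (R ψ) y) B)
        (fun ψ => (contDiff_totalWeight_moveVertices u v hR (R ψ) y A).sub
          (contDiff_totalWeight_moveVertices u v hR (R ψ) y B)) hKd hKb ht₀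
        (fun φ φ' ψ ψ' => by
          have := mixed_difference_totalWeight huv R y hA hB φ φ' ψ ψ'
          simp only [hG] at this
          exact this)
      filter_upwards [hmain] with ψ hψ
      filter_upwards [hψ] with φ hφ
      exact fun _ => sub_ne_zero.1 hφ
    -- Rotations keep the plane lengths, so a degenerate configuration stays degenerate.
    · refine Eventually.of_forall fun p hNp => absurd ?_ hNy
      simp only [hN, T, moveVertices, huv.symm, if_true, if_false, Prod.mk.eta, hRn] at hNp
      exact hNp
  have hswap : ∀ᵐ p : ℝ × ℝ, ∀ᵐ y ∂M, good (T p y) := by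
    rw [Measure.ae_ae_comm (p := fun p y => good (T p y)) (hTm hgood)]
    exact Eventually.of_forall hfib
  -- One good pair of angles suffices, since the corresponding move preserves the law.
  obtain ⟨p, hp⟩ := hswap.exists
  have hmp := measurePreserving_moveVertices (n := n) hQ u v (R p.2) (R p.1)
  rw [← hM] at hmp
  change ∀ᵐ y ∂M, good y
  rw [← hmp.map_eq, ae_map_iff hmp.measurable.aemeasurable hgood]
  exact hp

/-- Distinct sets of edges almost surely have distinct weights. -/
lemma ae_totalWeight_ne {n d : ℕ} (hd : 2 ≤ d) {Q : Measure (Bool → E d)}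
    [IsProbabilityMeasure Q] (hQ : IsBiinvariant Q) (hQ0 : ∀ᵐ q ∂Q, ∀ b, q b ≠ 0)
    {A B : Finset (Sym2 (Fin n × Bool))} (hA : ∀ e ∈ A, ¬ e.IsDiag) (hAB : ¬ A ⊆ B) :
    ∀ᵐ y ∂Measure.pi fun _ : Fin n => Q, totalWeight y A ≠ totalWeight y B := by
  obtain ⟨e, heA, heB⟩ := Finset.not_subset.1 hAB
  have hediag := hA e heA
  induction e using Sym2.ind with
  | _ u v =>
    have huv : u ≠ v := by simpa using hediag
    have hne : ∀ᵐ y ∂Measure.pi fun _ : Fin n => Q, ∀ i b, y i b ≠ 0 := by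
      rw [ae_all_iff]
      exact fun i => (Measure.quasiMeasurePreserving_eval (fun _ : Fin n => Q) i).ae
        (p := fun q => ∀ b, q b ≠ 0) hQ0
    have hall : ∀ᵐ y ∂Measure.pi fun _ : Fin n => Q, ∀ j k : Fin d, j ≠ k →
        (y u.1 u.2 j ^ 2 + y u.1 u.2 k ^ 2 ≠ 0 ∧ y v.1 v.2 j ^ 2 + y v.1 v.2 k ^ 2 ≠ 0) →
        totalWeight y A ≠ totalWeight y B := by
      simp only [ae_all_iff]
      exact fun j k hjk => ae_totalWeight_ne_of_coordinates hd hQ huv heA heB hjk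
    filter_upwards [hne, hall] with y hy hy'
    obtain ⟨j, k, hjk, h1, h2⟩ := exists_coordinates_ne_zero hd (hy u.1 u.2) (hy v.1 v.2)
    exact hy' j k hjk ⟨h1, h2⟩

end SphericalRuns

end

noncomputable section

namespace SphericalRuns

open scoped RealInnerProductSpace

/-! ### Exchangeability of a vector and its variant -/

open Pointwise in
-- Surface measure is, up to a factor, the volume of the cone over a set, and isometries carry cones
-- to cones and preserve volume.
lemma isSphericallySymmetric_uniformSphere (d : ℕ) : IsSphericallySymmetric (uniformSphere d) := by
  intro H
  unfold uniformSphere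
  rw [Measure.map_smul, Measure.map_smul]
  congr 1
  ext s hs
  have hv : Measurable fun u : Metric.sphere (0 : E d) 1 => (u : E d) := measurable_subtype_coe
  have hH : Measurable H := H.continuous.measurable
  rw [Measure.map_apply hH hs, Measure.map_apply hv (hH hs), Measure.map_apply hv hs,
    Measure.toSphere_apply' _ (hv (hH hs)), Measure.toSphere_apply' _ (hv hs)]
  congr 1
  have hpre : Set.Ioo (0 : ℝ) 1 • ((↑) '' ((fun u : Metric.sphere (0 : E d) 1 => (u : E d)) ⁻¹'
      (H ⁻¹' s)) : Set (E d)) = H ⁻¹' (Set.Ioo (0 : ℝ) 1 • ((↑) ''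
        ((fun u : Metric.sphere (0 : E d) 1 => (u : E d)) ⁻¹' s) : Set (E d))) := by
    ext x
    simp only [Set.mem_smul, Set.mem_image, Set.mem_preimage]
    constructor
    · rintro ⟨r, hr, -, ⟨u, hu, rfl⟩, rfl⟩
      exact ⟨r, hr, H u, ⟨⟨H u, by simp⟩, hu, rfl⟩, by simp⟩
    · rintro ⟨r, hr, -, ⟨u, hu, rfl⟩, hx⟩
      exact ⟨r, hr, H.symm u, ⟨⟨H.symm u, by simp⟩, by simpa using hu, rfl⟩,
        H.injective (by simpa using hx)⟩
  rw [hpre]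
  exact (H.measurePreserving).measure_preimage_equiv (f := H.toMeasurableEquiv) _

lemma isProbabilityMeasure_uniformSphere {d : ℕ} (hd : 2 ≤ d) :
    IsProbabilityMeasure (uniformSphere d) := by
  have : Nontrivial (Fin d) := Fin.nontrivial_iff_two_le.2 hd
  have : Nonempty (Fin d) := inferInstance
  have hne : (volume : Measure (E d)).toSphere ≠ 0 := Measure.toSphere_ne_zero _
  refine ⟨?_⟩
  unfold uniformSphere
  rw [Measure.map_apply measurable_subtype_coe MeasurableSet.univ, Set.preimage_univ,
    Measure.smul_apply, smul_eq_mul]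
  exact ENNReal.inv_mul_cancel (Measure.measure_univ_ne_zero.2 hne) (measure_ne_top _ _)

lemma ae_norm_eq_one_uniformSphere (d : ℕ) : ∀ᵐ u ∂uniformSphere d, ‖u‖ = 1 := by
  unfold uniformSphere
  rw [ae_map_iff (by fun_prop) (measurableSet_eq_fun (by fun_prop) (by fun_prop))]
  exact Eventually.of_forall fun u => by simp

/-- The law of the pair `(X, ‖X‖ U)` of a random vector and its spherically symmetric variant. -/
def pairLaw {d : ℕ} (P : Measure (E d)) : Measure (Bool → E d) :=
  (P.prod (uniformSphere d)).map fun p b => if b then p.1 else ‖p.1‖ • p.2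

lemma measurable_pairing {d : ℕ} :
    Measurable fun (p : E d × E d) (b : Bool) => if b then p.1 else ‖p.1‖ • p.2 := by
  refine measurable_pi_lambda _ fun b => ?_
  cases b
  · simp only [Bool.false_eq_true, if_false]; fun_prop
  · simp only [if_true]; fun_prop

section

variable {d : ℕ} {P : Measure (E d)}

lemma isProbabilityMeasure_pairLaw [IsProbabilityMeasure P]
    (hd : 2 ≤ d) : IsProbabilityMeasure (pairLaw P) := by
  have := isProbabilityMeasure_uniformSphere hd
  exact Measure.isProbabilityMeasure_map measurable_pairing.aemeasurable

lemma isBiinvariant_pairLaw [IsProbabilityMeasure P]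
    (hd : 2 ≤ d) (hP : IsSphericallySymmetric P) :
    IsBiinvariant (pairLaw P) := by
  have := isProbabilityMeasure_uniformSphere hd
  intro H
  have h1 : MeasurePreserving (H true) P P := ⟨(H true).continuous.measurable, hP _⟩
  have h2 : MeasurePreserving (H false) (uniformSphere d) (uniformSphere d) :=
    ⟨(H false).continuous.measurable, isSphericallySymmetric_uniformSphere d _⟩
  have h := (h1.prod h2).map_eq
  have hm : Measurable fun (q : Bool → E d) b => H b (q b) := measurable_pi_lambda _ fun b =>
    (H b).continuous.measurable.comp (measurable_pi_apply b)
  unfold pairLaw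
  conv_rhs => rw [← h]
  rw [Measure.map_map hm measurable_pairing, Measure.map_map measurable_pairing (by
    exact (h1.prod h2).measurable)]
  congr 1
  ext p b
  cases b <;> simp

lemma ae_ne_zero_pairLaw [NullSingletonClass P] (hd : 2 ≤ d) : ∀ᵐ q ∂pairLaw P, ∀ b, q b ≠ 0 := by
  have := isProbabilityMeasure_uniformSphere hd
  unfold pairLaw
  rw [ae_map_iff measurable_pairing.aemeasurable]
  · have h1 : ∀ᵐ x ∂P, x ≠ 0 := by
      rw [ae_iff]
      simp
    have h2 := ae_norm_eq_one_uniformSphere d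
    filter_upwards [Measure.quasiMeasurePreserving_fst.ae h1,
      Measure.quasiMeasurePreserving_snd.ae h2] with p hp1 hp2 b
    have : p.2 ≠ 0 := by
      rw [← norm_ne_zero_iff, hp2]; norm_num
    cases b <;> simp [hp1, this]
  · have : {q : Bool → E d | ∀ b, q b ≠ 0} = ⋂ b, (fun q => q b) ⁻¹' {0}ᶜ := by
      ext; simp
    rw [this]
    exact MeasurableSet.iInter fun b => (measurable_pi_apply b) (measurableSet_singleton _).compl

lemma exists_isometry_apply_eq {s t : E d} (h : ‖s‖ = ‖t‖) : ∃ H : E d ≃ₗᵢ[ℝ] E d, H s = t :=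
  ⟨_, Submodule.reflection_sub h⟩

lemma charFun_eq_of_norm_eq (hP : IsSphericallySymmetric P) {s t : E d} (h : ‖s‖ = ‖t‖) :
    charFun P s = charFun P t := by
  obtain ⟨H, rfl⟩ := exists_isometry_apply_eq h
  conv_rhs => rw [← hP H, charFun_apply,
    integral_map H.continuous.aemeasurable (by fun_prop)]
  simp only [LinearIsometryEquiv.inner_map_map, charFun_apply]

/-- This encodes uniformity of the direction given the norm. The left side depends only on ‖t‖, so t
can be averaged over its sphere; after Fubini the inner integral is the spherical characteristic
function at ‖t‖x, equal to that at ‖x‖t. -/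
lemma integral_exp_mul_radial [IsProbabilityMeasure P]
    {g : ℝ → ℂ} (hg : Measurable g) (hg1 : ∀ r, ‖g r‖ ≤ 1)
    (hd : 2 ≤ d) (hP : IsSphericallySymmetric P) (t : E d) :
    ∫ x, Complex.exp (⟪x, t⟫ * Complex.I) * g ‖x‖ ∂P =
      ∫ x, charFun (uniformSphere d) (‖x‖ • t) * g ‖x‖ ∂P := by
  have := isProbabilityMeasure_uniformSphere hd
  set σ := uniformSphere d
  let k : E d → ℂ := fun t => ∫ x, Complex.exp (⟪x, t⟫ * Complex.I) * g ‖x‖ ∂P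
  have hk : ∀ s t, ‖s‖ = ‖t‖ → k s = k t := by
    intro s t h
    obtain ⟨H, rfl⟩ := exists_isometry_apply_eq h
    simp only [k]
    conv_rhs => rw [← hP H, integral_map H.continuous.aemeasurable (by fun_prop)]
    simp only [LinearIsometryEquiv.inner_map_map, LinearIsometryEquiv.norm_map]
  have h1 : k t = ∫ u, k (‖t‖ • u) ∂σ := by
    have : ∀ᵐ u ∂σ, k (‖t‖ • u) = k t := by
      filter_upwards [ae_norm_eq_one_uniformSphere d] with u hu
      exact hk _ _ (by simp [norm_smul, hu])
    rw [integral_congr_ae this]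
    simp
  change k t = _
  rw [h1]
  simp only [k]
  rw [integral_integral_swap]
  · refine integral_congr_ae (Eventually.of_forall fun x => ?_)
    simp only
    rw [integral_mul_const, ← charFun_eq_of_norm_eq (isSphericallySymmetric_uniformSphere d)
      (s := ‖t‖ • x) (t := ‖x‖ • t) (by simp [norm_smul, mul_comm])]
    congr 1
    rw [charFun_apply]
    congr with u
    rw [real_inner_smul_right, real_inner_smul_right, real_inner_comm]
  · refine Integrable.of_bound (C := 1) ?_ (Eventually.of_forall fun p => ?_)
    · exact Measurable.aestronglyMeasurable (by
        simp only [Function.uncurry_def]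
        fun_prop)
    · simp only [Function.uncurry, norm_mul, Complex.norm_exp_ofReal_mul_I, one_mul]
      exact hg1 _

/-- The right side is symmetric in s and t, which is exchangeability at the level of characteristic
functions. -/
lemma integral_exp_pairLaw [IsProbabilityMeasure P]
    (hd : 2 ≤ d) (hP : IsSphericallySymmetric P) (s t : E d) :
    ∫ q, Complex.exp (((⟪q true, s⟫ + ⟪q false, t⟫ : ℝ) : ℂ) * Complex.I) ∂pairLaw P =
      ∫ x, charFun (uniformSphere d) (‖x‖ • s) * charFun (uniformSphere d) (‖x‖ • t) ∂P := by
  have := isProbabilityMeasure_uniformSphere hd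
  rw [← integral_exp_mul_radial (g := fun r => charFun (uniformSphere d) (r • t))
    (measurable_charFun.comp (by fun_prop)) (fun r => norm_charFun_le_one _) hd hP]
  unfold pairLaw
  rw [integral_map measurable_pairing.aemeasurable (Measurable.aestronglyMeasurable (by fun_prop)),
    integral_prod]
  · refine integral_congr_ae (Eventually.of_forall fun x => ?_)
    simp only [if_true, Bool.false_eq_true, if_false]
    rw [charFun_apply, ← integral_const_mul]
    congr with u
    rw [← Complex.exp_add, real_inner_smul_left, real_inner_smul_right]
    push_cast
    ring_nf
  · refine Integrable.of_bound (C := 1) (Measurable.aestronglyMeasurable ?_)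
      (Eventually.of_forall fun p => by rw [Complex.norm_exp_ofReal_mul_I])
    simp only [if_true, Bool.false_eq_true, if_false]
    fun_prop

/-- A spherically symmetric random vector and its variant are exchangeable. -/
lemma pairLaw_map_flip [IsProbabilityMeasure P] (hd : 2 ≤ d) (hP : IsSphericallySymmetric P) :
    (pairLaw P).map (fun q b => q (!b)) = pairLaw P := by
  have := isProbabilityMeasure_pairLaw (P := P) hd
  have hm : Measurable fun (q : Bool → E d) b => q (!b) := by fun_prop
  have := Measure.isProbabilityMeasure_map (μ := pairLaw P) hm.aemeasurable
  refine Measure.ext_of_charFunDual ?_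
  ext L
  -- Riesz representatives of the restrictions of L to the two coordinates.
  let s : E d := (InnerProductSpace.toDual ℝ (E d)).symm
    (L.comp (ContinuousLinearMap.single ℝ (fun _ : Bool => E d) true))
  let t : E d := (InnerProductSpace.toDual ℝ (E d)).symm
    (L.comp (ContinuousLinearMap.single ℝ (fun _ : Bool => E d) false))
  have hL : ∀ q : Bool → E d, L q = ⟪q true, s⟫ + ⟪q false, t⟫ := by
    intro q
    rw [real_inner_comm, real_inner_comm t]
    simp only [s, t, InnerProductSpace.toDual_symm_apply, ContinuousLinearMap.comp_apply,
      ContinuousLinearMap.single_apply]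
    rw [← map_add]
    congr 1
    ext b : 1
    cases b <;> simp
  rw [charFunDual_apply, charFunDual_apply, integral_map hm.aemeasurable (by fun_prop)]
  simp only [hL, Bool.not_true, Bool.not_false]
  rw [integral_exp_pairLaw hd hP s t]
  have := integral_exp_pairLaw hd hP t s
  simp only [mul_comm (charFun (uniformSphere d) (‖_‖ • t))] at this
  rw [← this]
  congr with q
  rw [add_comm]

end

lemma measurePreserving_configuration_of_coordinates {n d : ℕ} (hd : 2 ≤ d) (P : Measure (E d))
    [IsProbabilityMeasure P] :
    MeasurePreserving (fun (z : Fin n ⊕ Fin n → E d) (i : Fin n) (b : Bool) =>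
      if b then z (.inl i) else ‖z (.inl i)‖ • z (.inr i))
      (Measure.pi (Sum.elim (fun _ : Fin n => P) fun _ : Fin n => uniformSphere d))
      (Measure.pi fun _ : Fin n => pairLaw P) := by
  have := isProbabilityMeasure_uniformSphere hd
  have := isProbabilityMeasure_pairLaw (P := P) hd
  have hprob : ∀ v, IsProbabilityMeasure
      (Sum.elim (fun _ : Fin n => P) (fun _ : Fin n => uniformSphere d) v) := by
    rintro (i | i)
    · change IsProbabilityMeasure P; infer_instance
    · change IsProbabilityMeasure (uniformSphere d); infer_instance
  have m1 : MeasurePreserving (MeasurableEquiv.sumPiEquivProdPi fun _ : Fin n ⊕ Fin n => E d)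
      (Measure.pi (Sum.elim (fun _ : Fin n => P) fun _ : Fin n => uniformSphere d))
      ((Measure.pi fun _ : Fin n => P).prod (Measure.pi fun _ : Fin n => uniformSphere d)) :=
    measurePreserving_sumPiEquivProdPi _
  have m2 := (measurePreserving_arrowProdEquivProdArrow (E d) (E d) (Fin n) (fun _ => P)
    (fun _ => uniformSphere d)).symm
  have m3 := measurePreserving_pi (fun _ : Fin n => P.prod (uniformSphere d))
    (fun _ : Fin n => pairLaw P) fun _ => ⟨measurable_pairing, rfl⟩
  have m4 := m2.comp m1
  have m5 := m3.comp m4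
  exact m5

/-- The configuration of all vertices has independent coordinates with law `pairLaw P`. -/
lemma measurePreserving_configuration {Ω : Type*} [MeasurableSpace Ω] {μ : Measure Ω}
    [IsProbabilityMeasure μ] {n d : ℕ} (hd : 2 ≤ d) {P : Measure (E d)} [IsProbabilityMeasure P]
    {X U : Fin n → Ω → E d} (h : IsAugmentedSample μ P X U) :
    AEMeasurable (fun ω (i : Fin n) (b : Bool) => if b then X i ω else ‖X i ω‖ • U i ω) μ ∧
    μ.map (fun ω (i : Fin n) (b : Bool) => if b then X i ω else ‖X i ω‖ • U i ω) =
      Measure.pi fun _ : Fin n => pairLaw P := by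
  have := isProbabilityMeasure_uniformSphere hd
  have := isProbabilityMeasure_pairLaw (P := P) hd
  have hmeas : ∀ v, AEMeasurable (Sum.elim X U v) μ := by
    rintro (i | i)
    · exact (h.law_X i).aemeasurable
    · exact (h.law_U i).aemeasurable
  have hlaw : ∀ v, μ.map (Sum.elim X U v) =
      Sum.elim (fun _ : Fin n => P) (fun _ : Fin n => uniformSphere d) v := by
    rintro (i | i)
    · exact (h.law_X i).map_eq
    · exact (h.law_U i).map_eq
  have m := measurePreserving_configuration_of_coordinates (n := n) hd P
  have h0 := (iIndepFun_iff_map_fun_eq_pi_map hmeas).1 h.indep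
  simp only [hlaw] at h0
  have hae : AEMeasurable (fun ω v => Sum.elim X U v ω) μ := aemeasurable_pi_lambda _ hmeas
  obtain ⟨Φ, hΦ⟩ : ∃ Φ : (Fin n ⊕ Fin n → E d) → Fin n → Bool → E d, ∀ z i b,
      Φ z i b = if b then z (.inl i) else ‖z (.inl i)‖ • z (.inr i) := ⟨_, fun _ _ _ => rfl⟩
  have hΦ' : (fun (z : Fin n ⊕ Fin n → E d) (i : Fin n) (b : Bool) =>
      if b then z (.inl i) else ‖z (.inl i)‖ • z (.inr i)) = Φ := by
    funext z i b
    rw [hΦ]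
  have hcomp : (fun ω (i : Fin n) (b : Bool) => if b then X i ω else ‖X i ω‖ • U i ω) =
      Φ ∘ fun ω v => Sum.elim X U v ω := by
    funext ω i b
    simp only [Function.comp_apply, hΦ, Sum.elim_inl, Sum.elim_inr]
  rw [hΦ'] at m
  rw [hcomp]
  refine ⟨m.measurable.comp_aemeasurable hae, ?_⟩
  rw [← AEMeasurable.map_map_of_aemeasurable m.measurable.aemeasurable hae, h0, m.map_eq]

end SphericalRuns

end

noncomputable section

namespace SphericalRuns

/-! ### Minimal paths and pair flips -/

/-- The vertex at position `i` of the path `(s, π)`. -/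
def pathVertex {n : ℕ} (s : Fin n → Bool) (π : Equiv.Perm (Fin n)) (i : Fin n) : Fin n × Bool :=
  (π i, s (π i))

/-- The edge of the path `(s, π)` following position `i`. -/
def pathEdge {n : ℕ} (s : Fin n → Bool) (π : Equiv.Perm (Fin n)) (i : Fin (n - 1)) :
    Sym2 (Fin n × Bool) :=
  s(pathVertex s π (pos i), pathVertex s π (nextPos i))

/-- The set of edges of the path `(s, π)`. -/
def pathEdges {n : ℕ} (s : Fin n → Bool) (π : Equiv.Perm (Fin n)) :
    Finset (Sym2 (Fin n × Bool)) :=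
  Finset.univ.image (pathEdge s π)

/-- Whether the endpoints of an edge have different signs. -/
def signChange {n : ℕ} : Sym2 (Fin n × Bool) → ℕ :=
  Sym2.lift ⟨fun u v => if u.2 ≠ v.2 then 1 else 0, fun u v => by simp only [ne_comm]⟩

lemma pathVertex_injective {n : ℕ} (s : Fin n → Bool) (π : Equiv.Perm (Fin n)) :
    Function.Injective (pathVertex s π) := fun _ _ h => π.injective (Prod.ext_iff.1 h).1

/-- This lets cost and runs be summed over the edge set, forgetting the order of traversal. -/
lemma pathEdge_injective {n : ℕ} (s : Fin n → Bool) (π : Equiv.Perm (Fin n)) :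
    Function.Injective (pathEdge s π) := by
  intro i j h
  have hinj := pathVertex_injective s π
  simp only [pathEdge, Sym2.eq_iff, hinj.eq_iff, pos, nextPos, Fin.mk.injEq] at h
  ext
  omega

lemma not_isDiag_of_mem_pathEdges {n : ℕ} {s : Fin n → Bool} {π : Equiv.Perm (Fin n)}
    {e : Sym2 (Fin n × Bool)} (he : e ∈ pathEdges s π) : ¬ e.IsDiag := by
  obtain ⟨i, -, rfl⟩ := Finset.mem_image.1 he
  simp only [pathEdge, Sym2.mk_isDiag_iff, (pathVertex_injective s π).eq_iff, pos, nextPos,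
    Fin.mk.injEq]
  omega

lemma pathCost_eq_totalWeight {n d : ℕ} (x x' : Fin n → E d) (s : Fin n → Bool)
    (π : Equiv.Perm (Fin n)) :
    pathCost x x' s π = totalWeight (fun i (b : Bool) => if b then x i else x' i)
      (pathEdges s π) := by
  rw [totalWeight, pathEdges, Finset.sum_image (pathEdge_injective s π).injOn]
  rfl

lemma runsStatistic_eq_sum_signChange {n : ℕ} (s : Fin n → Bool) (π : Equiv.Perm (Fin n)) :
    runsStatistic s π = 1 + ∑ e ∈ pathEdges s π, signChange e := by
  rw [pathEdges, Finset.sum_image (pathEdge_injective s π).injOn]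
  rfl

/-- The path `(s, π)` has minimal weight in the configuration `y`. -/
def IsMinimalPath {n d : ℕ} (y : Fin n → Bool → E d) (s : Fin n → Bool)
    (π : Equiv.Perm (Fin n)) : Prop :=
  ∀ t σ, totalWeight y (pathEdges s π) ≤ totalWeight y (pathEdges t σ)

lemma exists_isMinimalPath {n d : ℕ} (y : Fin n → Bool → E d) :
    ∃ s π, IsMinimalPath y s π := by
  obtain ⟨p, hp⟩ := Finite.exists_min fun p : (Fin n → Bool) × Equiv.Perm (Fin n) =>
    totalWeight y (pathEdges p.1 p.2)
  exact ⟨p.1, p.2, fun t σ => hp (t, σ)⟩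

/-- Distinct paths have distinct weights. -/
def IsTieFree {n d : ℕ} (y : Fin n → Bool → E d) : Prop :=
  ∀ s π t σ, pathEdges s π ≠ pathEdges t σ →
    totalWeight y (pathEdges s π) ≠ totalWeight y (pathEdges t σ)

lemma ae_isTieFree {n d : ℕ} (hd : 2 ≤ d) {Q : Measure (Bool → E d)} [IsProbabilityMeasure Q]
    (hQ : IsBiinvariant Q) (hQ0 : ∀ᵐ q ∂Q, ∀ b, q b ≠ 0) :
    ∀ᵐ y ∂Measure.pi fun _ : Fin n => Q, IsTieFree y := by
  simp only [IsTieFree, ae_all_iff]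
  intro s π t σ hne
  by_cases h : pathEdges s π ⊆ pathEdges t σ
  · have h' : ¬ pathEdges t σ ⊆ pathEdges s π := fun h' => hne (h.antisymm h')
    filter_upwards [ae_totalWeight_ne hd hQ hQ0 (fun e => not_isDiag_of_mem_pathEdges) h'] with y hy
    exact hy.symm
  · exact ae_totalWeight_ne hd hQ hQ0 (fun e => not_isDiag_of_mem_pathEdges) h

open Classical in
/-- The runs statistic of the minimal path, as a measurable function of the configuration. -/
def minimalRuns {n d : ℕ} (y : Fin n → Bool → E d) : ℕ :=
  -- Summing over edge sets counts a path and its reversal once; without ties exactly one term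
  -- survives.
  ∑ A ∈ Finset.univ.image fun p : (Fin n → Bool) × Equiv.Perm (Fin n) => pathEdges p.1 p.2,
    if ∀ t σ, totalWeight y A ≤ totalWeight y (pathEdges t σ) then
      1 + ∑ e ∈ A, signChange e else 0

lemma measurable_minimalRuns {n d : ℕ} :
    Measurable (minimalRuns : (Fin n → Bool → E d) → ℕ) := by
  classical
  refine Finset.measurable_fun_sum _ fun A _ => Measurable.ite ?_ measurable_const measurable_const
  have : {y : Fin n → Bool → E d | ∀ t σ, totalWeight y A ≤ totalWeight y (pathEdges t σ)} =
      ⋂ t, ⋂ σ, {y | totalWeight y A ≤ totalWeight y (pathEdges t σ)} := by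
    ext; simp
  rw [this]
  exact MeasurableSet.iInter fun t => MeasurableSet.iInter fun σ =>
    measurableSet_le (measurable_totalWeight A) (measurable_totalWeight _)

lemma IsMinimalPath.minimalRuns_eq {n d : ℕ} {y : Fin n → Bool → E d} {s : Fin n → Bool}
    {π : Equiv.Perm (Fin n)} (h : IsMinimalPath y s π) (hy : IsTieFree y) :
    minimalRuns y = runsStatistic s π := by
  classical
  rw [runsStatistic_eq_sum_signChange, minimalRuns,
    Finset.sum_eq_single_of_mem (pathEdges s π)
      (Finset.mem_image.2 ⟨(s, π), Finset.mem_univ _, rfl⟩)]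
  · exact if_pos h
  · intro A hA hne
    obtain ⟨⟨t, σ⟩, -, rfl⟩ := Finset.mem_image.1 hA
    exact if_neg fun hmin => hy t σ s π hne ((hmin s π).antisymm (h t σ))

/-- Exchanging the two vertices of the pairs selected by `τ`. -/
def flipConfig {n d : ℕ} (τ : Fin n → Bool) (y : Fin n → Bool → E d) : Fin n → Bool → E d :=
  fun i b => y i (xor (τ i) b)

lemma totalWeight_flipConfig {n d : ℕ} (τ : Fin n → Bool) (y : Fin n → Bool → E d)
    (s : Fin n → Bool) (π : Equiv.Perm (Fin n)) :
    totalWeight (flipConfig τ y) (pathEdges s π) =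
      totalWeight y (pathEdges (fun i => xor (τ i) (s i)) π) := by
  simp only [totalWeight, pathEdges]
  rw [Finset.sum_image (pathEdge_injective s π).injOn,
    Finset.sum_image (pathEdge_injective _ π).injOn]
  rfl

lemma IsMinimalPath.flipConfig {n d : ℕ} {y : Fin n → Bool → E d} {s : Fin n → Bool}
    {π : Equiv.Perm (Fin n)} (h : IsMinimalPath y s π) (τ : Fin n → Bool) :
    IsMinimalPath (flipConfig τ y) (fun i => xor (τ i) (s i)) π := by
  intro t σ
  rw [totalWeight_flipConfig, totalWeight_flipConfig]
  simpa using h _ σ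

lemma measurePreserving_flipConfig {n d : ℕ} {Q : Measure (Bool → E d)} [IsProbabilityMeasure Q]
    (hQ : Q.map (fun q b => q (!b)) = Q) (τ : Fin n → Bool) :
    MeasurePreserving (flipConfig τ) (Measure.pi fun _ : Fin n => Q)
      (Measure.pi fun _ : Fin n => Q) := by
  refine measurePreserving_pi (f := fun (i : Fin n) (q : Bool → E d) (b : Bool) =>
      q (xor (τ i) b)) _ _ fun i => ⟨by fun_prop, ?_⟩
  cases τ i
  · simp only [Bool.false_xor]
    exact Measure.map_id
  · simpa only [Bool.true_xor] using hQ

/-- Xor with s permutes the sign vectors and π merely relabels positions, so the sum forgets the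
path. -/
lemma sum_flip_runsStatistic {n : ℕ} (g : ℕ → ℂ) (s : Fin n → Bool) (π : Equiv.Perm (Fin n)) :
    ∑ τ : Fin n → Bool, g (runsStatistic (fun i => xor (τ i) (s i)) π) =
      ∑ t : Fin n → Bool, g (runsStatistic t 1) := by
  have hinv : Function.Involutive fun (τ : Fin n → Bool) i => xor (τ i) (s i) := fun τ => by
    funext i; simp
  rw [Function.Bijective.sum_comp hinv.bijective fun t => g (runsStatistic t π),
    ← Equiv.sum_comp (Equiv.arrowCongr π (Equiv.refl Bool))]
  refine Finset.sum_congr rfl fun t _ => ?_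
  simp only [runsStatistic, Equiv.arrowCongr_apply, Equiv.coe_refl, Function.comp_apply, id,
    Equiv.symm_apply_apply, Equiv.Perm.one_apply]
  congr!

/-- The law of the runs statistic of the minimal path is that of a uniformly random sign vector. -/
lemma integral_minimalRuns {n d : ℕ} (hd : 2 ≤ d) {Q : Measure (Bool → E d)}
    [IsProbabilityMeasure Q] (hQ : IsBiinvariant Q) (hQ0 : ∀ᵐ q ∂Q, ∀ b, q b ≠ 0)
    (hQf : Q.map (fun q b => q (!b)) = Q) {g : ℕ → ℂ} (hg : ∀ k, ‖g k‖ ≤ 1) :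
    ∫ y, g (minimalRuns y) ∂(Measure.pi fun _ : Fin n => Q) =
      (∑ t : Fin n → Bool, g (runsStatistic t 1)) / 2 ^ n := by
  set M := Measure.pi fun _ : Fin n => Q with hM
  have hgm : Measurable fun y : Fin n → Bool → E d => g (minimalRuns y) :=
    (measurable_from_nat).comp measurable_minimalRuns
  have hflip : ∀ τ : Fin n → Bool, ∫ y, g (minimalRuns (flipConfig τ y)) ∂M =
      ∫ y, g (minimalRuns y) ∂M := by
    intro τ
    have hmp := measurePreserving_flipConfig (n := n) hQf τ
    rw [← hM] at hmp
    conv_rhs => rw [← hmp.map_eq]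
    rw [integral_map hmp.measurable.aemeasurable hgm.aestronglyMeasurable]
  have htf : ∀ᵐ y ∂M, ∀ τ : Fin n → Bool, IsTieFree (flipConfig τ y) := by
    rw [ae_all_iff]
    exact fun τ => (measurePreserving_flipConfig hQf τ).quasiMeasurePreserving.ae
      (ae_isTieFree hd hQ hQ0)
  -- The sum over flips is almost surely constant, while its 2^n terms share one integral.
  have hsum : ∀ᵐ y ∂M, ∑ τ : Fin n → Bool, g (minimalRuns (flipConfig τ y)) =
      ∑ t : Fin n → Bool, g (runsStatistic t 1) := by
    filter_upwards [htf] with y hy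
    obtain ⟨s, π, h⟩ := exists_isMinimalPath y
    rw [← sum_flip_runsStatistic g s π]
    exact Finset.sum_congr rfl fun τ _ => by rw [(h.flipConfig τ).minimalRuns_eq (hy τ)]
  have hint := integral_congr_ae hsum
  rw [integral_finsetSum] at hint
  · simp only [hflip, Finset.sum_const, Finset.card_univ, Fintype.card_pi, Fintype.card_bool,
      Finset.prod_const, Fintype.card_fin, nsmul_eq_mul, integral_const, probReal_univ,
      one_smul] at hint
    rw [eq_div_iff (pow_ne_zero n two_ne_zero), ← hint]
    push_cast
    ring
  · intro τ _
    refine Integrable.of_bound (C := 1) ?_ (Eventually.of_forall fun y => hg _)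
    exact (hgm.comp (measurePreserving_flipConfig hQf τ).measurable).aestronglyMeasurable

/-! ### Runs of fair bits and their Gaussian limit -/

/-- Given the rest of the chain, a bit added in front either differs from its neighbour or agrees
with it: a factor p + q. -/
lemma sum_prod_sign_chain (p q : ℂ) (m : ℕ) :
    ∑ t : Fin (m + 1) → Bool, ∏ i : Fin m, (if t i.castSucc ≠ t i.succ then p else q) =
      2 * (p + q) ^ m := by
  induction m with
  | zero => simp
  | succ m ih =>
    rw [← (Fin.consEquiv fun _ : Fin (m + 2) => Bool).sum_comp, Fintype.sum_prod_type_right]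
    have : ∀ t : Fin (m + 1) → Bool, ∑ b : Bool, ∏ i : Fin (m + 1),
        (if (Fin.consEquiv fun _ : Fin (m + 2) => Bool) (b, t) i.castSucc ≠
          (Fin.consEquiv fun _ : Fin (m + 2) => Bool) (b, t) i.succ then p else q) =
        (p + q) * ∏ i : Fin m, (if t i.castSucc ≠ t i.succ then p else q) := by
      intro t
      simp only [Fin.consEquiv_apply, Fin.prod_univ_succ, Fin.castSucc_zero, Fin.cons_zero,
        Fin.cons_succ, Fin.castSucc_succ, ← Finset.sum_mul]
      congr 1
      cases t 0 <;> simp [add_comm]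
    rw [Finset.sum_congr rfl fun t _ => this t, ← Finset.mul_sum, ih]
    ring

/-- The characteristic function of the normalized number of runs of uniformly random signs. -/
lemma sum_exp_normalizedRuns (m : ℕ) (u : ℝ) :
    (∑ t : Fin (m + 1) → Bool,
      Complex.exp (u * ((((runsStatistic t 1 : ℕ) : ℝ) - (((m + 1 : ℕ) : ℝ) + 1) / 2) /
        √((m + 1 : ℕ) : ℝ) : ℝ) * Complex.I)) / 2 ^ (m + 1) =
      ((Real.cos (u / (2 * √((m + 1 : ℕ) : ℝ))) ^ m : ℝ) : ℂ) := by
  set r : ℝ := √((m + 1 : ℕ) : ℝ) with hr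
  -- As 1 - (m + 2)/2 = -m/2, the centred statistic is half a sum of m signs ±1; hence the 2.
  set θ : ℝ := u / (2 * r) with hθ
  have hr0 : r ≠ 0 := by positivity
  have hterm : ∀ t : Fin (m + 1) → Bool,
      Complex.exp (u * ((((runsStatistic t 1 : ℕ) : ℝ) - (((m + 1 : ℕ) : ℝ) + 1) / 2) / r : ℝ) *
        Complex.I) = ∏ i : Fin m, (if t i.castSucc ≠ t i.succ then Complex.exp (θ * Complex.I)
          else Complex.exp (-θ * Complex.I)) := by
    intro t
    have h1 : ∀ i : Fin m, (if t i.castSucc ≠ t i.succ then Complex.exp (θ * Complex.I)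
          else Complex.exp (-θ * Complex.I)) =
        Complex.exp (((θ * (2 * ((if t i.castSucc ≠ t i.succ then 1 else 0 : ℕ) : ℝ) - 1) : ℝ) :
          ℂ) * Complex.I) := by
      intro i
      split_ifs
      · congr 3; push_cast; ring_nf
      · congr 2; push_cast; ring
    simp only [h1]
    rw [← Complex.exp_sum, ← Finset.sum_mul, ← Complex.ofReal_sum, ← Complex.ofReal_mul]
    congr 3
    have h2 : runsStatistic t 1 = 1 + ∑ i : Fin m, if t i.castSucc ≠ t i.succ then 1 else 0 := rfl
    rw [h2, ← Finset.mul_sum, Finset.sum_sub_distrib, ← Finset.mul_sum, ← Nat.cast_sum]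
    simp only [Finset.sum_const, Finset.card_univ, Fintype.card_fin, nsmul_eq_mul, mul_one, hθ]
    push_cast
    field_simp
    ring
  simp only [hterm]
  rw [sum_prod_sign_chain, ← Complex.two_cos]
  push_cast
  rw [mul_pow]
  field_simp
  ring

/-- Writing cos x - 1 = -2 sin²(x/2) through sinc gives m(cos x - 1) → -u²/8, including u = 0; then
(1 + a/m)^m → e^a. -/
lemma tendsto_cos_pow (u : ℝ) :
    Tendsto (fun m : ℕ => Real.cos (u / (2 * √((m + 1 : ℕ) : ℝ))) ^ m) atTop
      (nhds (Real.exp (-(u ^ 2 / 8)))) := by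
  have hx : Tendsto (fun m : ℕ => u / (2 * √((m + 1 : ℕ) : ℝ)) / 2) atTop (nhds 0) := by
    have h1 : Tendsto (fun m : ℕ => 2 * √((m + 1 : ℕ) : ℝ)) atTop atTop :=
      (Real.tendsto_sqrt_atTop.comp (tendsto_natCast_atTop_atTop.comp
        (tendsto_add_atTop_nat 1))).const_mul_atTop two_pos
    simpa using (tendsto_const_nhds.div_atTop h1).div_const 2
  have hs : Tendsto (fun m : ℕ => Real.sinc (u / (2 * √((m + 1 : ℕ) : ℝ)) / 2)) atTop
      (nhds 1) := by
    have h := (Real.continuous_sinc.tendsto 0).comp hx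
    rwa [Real.sinc_zero] at h
  have hq : Tendsto (fun m : ℕ => (m : ℝ) / (m + 1)) atTop (nhds 1) :=
    tendsto_natCast_div_add_atTop 1
  have hlim : Tendsto (fun m : ℕ => (m : ℝ) * (Real.cos (u / (2 * √((m + 1 : ℕ) : ℝ))) - 1))
      atTop (nhds (-(u ^ 2 / 8))) := by
    have h := ((hq.mul (hs.pow 2)).const_mul (-(u ^ 2 / 8)))
    simp only [one_pow, mul_one] at h
    refine h.congr fun m => ?_
    set x := u / (2 * √((m + 1 : ℕ) : ℝ)) with hxdef
    have hsin : Real.sin (x / 2) = x / 2 * Real.sinc (x / 2) := by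
      by_cases h0 : x / 2 = 0
      · simp [h0]
      · rw [Real.sinc_of_ne_zero h0, mul_div_cancel₀ _ h0]
    have hcos : Real.cos x - 1 = -2 * Real.sin (x / 2) ^ 2 := by
      have := Real.cos_sq' (x / 2)
      have h2 := Real.cos_two_mul (x / 2)
      rw [mul_div_cancel₀ x two_ne_zero] at h2
      linarith
    have hx2 : x ^ 2 = u ^ 2 / (4 * (m + 1)) := by
      rw [hxdef, div_pow, mul_pow, Real.sq_sqrt (by positivity)]
      push_cast
      norm_num
    rw [hcos, hsin, mul_pow, div_pow, hx2]
    field_simp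
    ring
  have := Real.tendsto_one_add_pow_exp_of_tendsto hlim
  simpa using this

end SphericalRuns

end

namespace SphericalRuns

/-! ### Transfer to the sample and conclusion -/

/-- The normalized runs statistic of a shortest covering path is measurable up to a null set, and
its characteristic function is that of the normalized number of runs of uniformly random signs. -/
lemma charFun_map_normalizedRuns {Ω : Type*} [MeasurableSpace Ω] {μ : Measure Ω}
    [IsProbabilityMeasure μ] {n : ℕ} {d : Dim} {P : Measure (E d)} [IsProbabilityMeasure P]
    [NullSingletonClass P] (hP : IsSphericallySymmetric P) {X U : Fin n → Ω → E d}
    (hXU : IsAugmentedSample μ P X U) {S : Ω → Fin n → Bool} {π : Ω → Equiv.Perm (Fin n)}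
    (hmin : ∀ᵐ ω ∂μ, IsShortestCoveringPath (fun i => X i ω)
      (variant (fun i => X i ω) fun i => U i ω) (S ω) (π ω)) :
    AEMeasurable (fun ω => normalizedRuns (S ω) (π ω)) μ ∧
    ∀ u : ℝ, charFun (μ.map fun ω => normalizedRuns (S ω) (π ω)) u =
      (∑ t : Fin n → Bool,
        Complex.exp (u * ((((runsStatistic t 1 : ℕ) : ℝ) - ((n : ℝ) + 1) / 2) / √(n : ℝ) : ℝ) *
          Complex.I)) / 2 ^ n := by
  have := isProbabilityMeasure_pairLaw (P := P) d.2
  obtain ⟨hY, hYlaw⟩ := measurePreserving_configuration d.2 hXU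
  set Y : Ω → Fin n → Bool → E d := fun ω i b => if b then X i ω else ‖X i ω‖ • U i ω
  let N : ℕ → ℝ := fun k => ((k : ℝ) - ((n : ℝ) + 1) / 2) / √(n : ℝ)
  have htf := ae_isTieFree (n := n) d.2 (isBiinvariant_pairLaw d.2 hP)
    (ae_ne_zero_pairLaw (P := P) d.2)
  rw [← hYlaw] at htf
  have hNm : Measurable fun y : Fin n → Bool → E d => N (minimalRuns y) :=
    (measurable_from_nat (f := N)).comp measurable_minimalRuns
  -- S and π need not be measurable; almost sure uniqueness of the optimal edge set equates the
  -- statistic with a measurable one.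
  have heq : (fun ω => normalizedRuns (S ω) (π ω)) =ᵐ[μ] fun ω => N (minimalRuns (Y ω)) := by
    filter_upwards [hmin, ae_of_ae_map hY htf] with ω hω hω'
    have : IsMinimalPath (Y ω) (S ω) (π ω) := fun t σ => by
      have h := hω t σ
      rwa [pathCost_eq_totalWeight, pathCost_eq_totalWeight] at h
    rw [this.minimalRuns_eq hω']
    rfl
  have hmeas : AEMeasurable (fun ω => N (minimalRuns (Y ω))) μ := hNm.comp_aemeasurable hY
  refine ⟨hmeas.congr heq.symm, fun u => ?_⟩
  rw [Measure.map_congr heq, charFun_apply_real, integral_map hmeas (by fun_prop)]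
  have hmap := integral_map (f := fun y => Complex.exp (u * (N (minimalRuns y) : ℝ) * Complex.I))
    hY (((Complex.measurable_ofReal.comp hNm).const_mul (u : ℂ)).mul_const
      Complex.I).cexp.aestronglyMeasurable
  rw [← hmap, hYlaw]
  refine integral_minimalRuns (g := fun k => Complex.exp (u * (N k : ℝ) * Complex.I)) d.2
    (isBiinvariant_pairLaw d.2 hP) (ae_ne_zero_pairLaw d.2) (pairLaw_map_flip d.2 hP) fun k => ?_
  rw [← Complex.ofReal_mul, Complex.norm_exp_ofReal_mul_I]

end SphericalRuns

theorem theorem3p5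
    -- for every dimension `d > 1`, a continuous spherically symmetric distribution on `ℝ ^ d`
    (P : (d : SphericalRuns.Dim) → Measure (SphericalRuns.E d))
    [∀ d, NullSingletonClass (P d)]
    (hP_symm : ∀ d, SphericalRuns.IsSphericallySymmetric (P d))
    -- for every sample size `n` and dimension `d`, a sample together with the uniform directions
    {Ω : ℕ → SphericalRuns.Dim → Type*} [∀ n d, MeasurableSpace (Ω n d)]
    (μ : (n : ℕ) → (d : SphericalRuns.Dim) → Measure (Ω n d))
    [∀ n d, IsProbabilityMeasure (μ n d)]
    (X U : (n : ℕ) → (d : SphericalRuns.Dim) → Fin n → Ω n d → SphericalRuns.E d)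
    (hXU : ∀ n d, SphericalRuns.IsAugmentedSample (μ n d) (P d) (X n d) (U n d))
    -- string signs and the arrangement along the shortest covering path
    (S : (n : ℕ) → (d : SphericalRuns.Dim) → Ω n d → Fin n → Bool)
    (Pi : (n : ℕ) → (d : SphericalRuns.Dim) → Ω n d → Equiv.Perm (Fin n))
    (hSPi : ∀ n d, ∀ᵐ ω ∂(μ n d),
      SphericalRuns.IsShortestCoveringPath (fun i => X n d i ω)
        (SphericalRuns.variant (fun i => X n d i ω) (fun i => U n d i ω))
        (S n d ω) (Pi n d ω)) :
    -- convergence in distribution as `n` and `d` tend to infinity, at arbitrary rates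
    TendstoInDistribution
      (fun (p : ℕ × SphericalRuns.Dim) (ω : Ω p.1 p.2) =>
        SphericalRuns.normalizedRuns (S p.1 p.2 ω) (Pi p.1 p.2 ω))
      (atTop ×ˢ atTop) (id : ℝ → ℝ) (fun p => μ p.1 p.2) (gaussianReal 0 (1 / 4)) ∧
    -- the limit is the same in every fixed dimension
    ∀ d : SphericalRuns.Dim,
      TendstoInDistribution
        (fun (n : ℕ) (ω : Ω n d) => SphericalRuns.normalizedRuns (S n d ω) (Pi n d ω))
        atTop (id : ℝ → ℝ) (fun n => μ n d) (gaussianReal 0 (1 / 4)) := by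
  have hPprob : ∀ d, IsProbabilityMeasure (P d) := fun d => by
    rw [← ((hXU 1 d).law_X 0).map_eq]
    exact Measure.isProbabilityMeasure_map ((hXU 1 d).law_X 0).aemeasurable
  have hrep := fun n d => SphericalRuns.charFun_map_normalizedRuns (hP_symm d) (hXU n d) (hSPi n d)
  have hmeas : ∀ n d, AEMeasurable
      (fun ω => SphericalRuns.normalizedRuns (S n d ω) (Pi n d ω)) (μ n d) :=
    fun n d => (hrep n d).1
  let law : ℕ → SphericalRuns.Dim → ProbabilityMeasure ℝ := fun n d =>
    ⟨(μ n d).map fun ω => SphericalRuns.normalizedRuns (S n d ω) (Pi n d ω),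
      Measure.isProbabilityMeasure_map (hmeas n d)⟩
  let d₀ : SphericalRuns.Dim := ⟨2, le_rfl⟩
  have hlaw : ∀ n d, law n d = law n d₀ := fun n d => by
    refine Subtype.ext (Measure.ext_of_charFun ?_)
    funext u
    exact ((hrep n d).2 u).trans ((hrep n d₀).2 u).symm
  let limit : ProbabilityMeasure ℝ := ⟨(gaussianReal 0 (1 / 4)).map id,
    Measure.isProbabilityMeasure_map aemeasurable_id⟩
  have hlim : Tendsto (fun n => law n d₀) atTop (nhds limit) := by
    refine ProbabilityMeasure.tendsto_of_tendsto_charFun fun u => ?_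
    have hl : charFun (limit : Measure ℝ) u = ((Real.exp (-(u ^ 2 / 8)) : ℝ) : ℂ) := by
      change charFun ((gaussianReal 0 (1 / 4)).map id) u = _
      rw [Measure.map_id, charFun_gaussianReal]
      push_cast
      congr 1
      ring
    -- With n = m + 1 the exponent n - 1 is m, and n = 0 is avoided.
    rw [hl, ← tendsto_add_atTop_iff_nat 1]
    refine ((Complex.continuous_ofReal.tendsto _).comp (SphericalRuns.tendsto_cos_pow u)).congr
      fun m => ?_
    rw [Function.comp_apply, ← SphericalRuns.sum_exp_normalizedRuns]
    exact ((hrep (m + 1) d₀).2 u).symm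
  constructor
  · refine ⟨fun p => hmeas p.1 p.2, aemeasurable_id, ?_⟩
    -- The law is constant in d, so only the first coordinate of the joint limit matters.
    refine Tendsto.congr (fun p => (hlaw p.1 p.2).symm) ?_
    exact hlim.comp tendsto_fst
  · intro d
    refine ⟨fun n => hmeas n d, aemeasurable_id, ?_⟩
    exact Tendsto.congr (fun n => (hlaw n d).symm) hlim
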